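/- For a unital $C^*$-algebra $A$ let $P_A$ be the set of continuous functions $f:[0,\infty)\to\mathbb{R}$ such that $f(x)\le f(y)$ for all self-adjoint $x,y\in A$ with spectrum in $[0,\infty)$ and $x\le y$ (where $f(x)$ is given by the continuous functional calculus). For a positive integer $n$ put $P_n=P_{M_n(\mathbb{C})}$, and let $P_\infty=\bigcap_{n\ge 1}P_n$; this is the class of operator monotone functions, that is, $P_\infty=P_{B(K)}$ for every infinite-dimensional complex Hilbert space $K$. An irreducible representation of $A$ is a unital $*$-homomorphism $\pi:A\to B(H)$, with $H\neq 0$ a complex Hilbert space, such that $0$ and $H$ are the only closed $\pi(A)$-invariant subspaces; its dimension is $\dim H$. **Lemma.** Let $A$ be a unital $C^*$-algebra. 1. If $A$ has an irreducible representation of finite dimension $n$, then $P_A\subseteq P_n$. 2. If $n$ is a positive integer and every irreducible representation of $A$ has dimension at most $n$, then $P_n\subseteq P_A$. 3. If the set of dimensions of finite-dimensional irreducible representations of $A$ is unbounded, then every $A$-monotone function is operator monotone, and in fact $P_A=P_\infty$. 4. If $A$ has an infinite-dimensional irreducible representation, then every $A$-monotone function is operator monotone, and in fact $P_A=P_\infty$.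 -/

import Mathlib

open scoped MatrixOrder

/-- The class `P_A(I)` of `A`-monotone functions on `I`: functions that are continuous on `I` and
satisfy `f(x) ≤ f(y)` for all self-adjoint `x ≤ y` in `A` with spectrum in `I`. A function on `I` is
represented by a total function `ℝ → ℝ`; membership depends only on its values on `I`. -/
def monotoneClass (I : Set ℝ) (A : Type*) [Ring A] [StarRing A] [Algebra ℝ A] [TopologicalSpace A]
    [PartialOrder A] [ContinuousFunctionalCalculus ℝ A IsSelfAdjoint] : Set (ℝ → ℝ) :=
  {f | ContinuousOn f I ∧ ∀ x y : A, IsSelfAdjoint x → IsSelfAdjoint y →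
    spectrum ℝ x ⊆ I → spectrum ℝ y ⊆ I → x ≤ y → cfc f x ≤ cfc f y}

/-- The class `P_n(I)` of matrix monotone functions of order `n` on `I`, for complex `n × n`
matrices with the Loewner order. -/
def matrixMonotoneClass (I : Set ℝ) (n : ℕ) : Set (ℝ → ℝ) :=
  monotoneClass I (Matrix (Fin n) (Fin n) ℂ)

/-- The class `P_∞(I)`, the intersection of all `P_n(I)` with `n ≥ 1`. -/
def matrixMonotoneClassInf (I : Set ℝ) : Set (ℝ → ℝ) :=
  ⋂ n : ℕ, ⋂ _ : 1 ≤ n, matrixMonotoneClass I n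

/-- A unital *-representation on a Hilbert space `H` is irreducible if `H ≠ 0` and the only closed
invariant subspaces are `0` and `H`. -/
def IsIrreducibleRep {A H : Type*} [CStarAlgebra A] [NormedAddCommGroup H] [InnerProductSpace ℂ H]
    [CompleteSpace H] (π : A →⋆ₐ[ℂ] (H →L[ℂ] H)) : Prop :=
  Nontrivial H ∧ ∀ K : Submodule ℂ H, IsClosed (K : Set H) →
    (∀ a : A, ∀ v ∈ K, π a v ∈ K) → K = ⊥ ∨ K = ⊤

/-- `A` has an irreducible representation of finite dimension `n`
(on a Hilbert space in the universe `v`). -/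
def HasIrrepOfDim.{v, u} (A : Type u) [CStarAlgebra A] (n : ℕ) : Prop :=
  ∃ (H : Type v) (_ : NormedAddCommGroup H) (_ : InnerProductSpace ℂ H) (_ : CompleteSpace H)
    (π : A →⋆ₐ[ℂ] (H →L[ℂ] H)),
    IsIrreducibleRep π ∧ FiniteDimensional ℂ H ∧ Module.finrank ℂ H = n

/-- `A` has an infinite-dimensional irreducible representation
(on a Hilbert space in the universe `v`). -/
def HasInfiniteDimIrrep.{v, u} (A : Type u) [CStarAlgebra A] : Prop :=
  ∃ (H : Type v) (_ : NormedAddCommGroup H) (_ : InnerProductSpace ℂ H) (_ : CompleteSpace H)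
    (π : A →⋆ₐ[ℂ] (H →L[ℂ] H)), IsIrreducibleRep π ∧ ¬ FiniteDimensional ℂ H

/-- Every irreducible representation of `A` has dimension at most `n`. Hilbert spaces in the
universe of `A` suffice, since an irreducible representation is cyclic and hence unitarily
equivalent to one on a completion of a quotient of `A`. -/
def IrrepDimsLE.{u} (A : Type u) [CStarAlgebra A] (n : ℕ) : Prop :=
  ∀ (H : Type u) [NormedAddCommGroup H] [InnerProductSpace ℂ H] [CompleteSpace H]
    (π : A →⋆ₐ[ℂ] (H →L[ℂ] H)), IsIrreducibleRep π →
    FiniteDimensional ℂ H ∧ Module.finrank ℂ H ≤ n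

/-- `S` is the class of operator monotone functions on `I`: it is `P_∞(I)`, and it is `P_{B(K)}(I)`
for every infinite-dimensional Hilbert space `K` (in the universe `w`). -/
def IsOperatorMonotoneClass.{w} (I : Set ℝ) (S : Set (ℝ → ℝ)) : Prop :=
  S = matrixMonotoneClassInf I ∧
    ∀ (K : Type w) [NormedAddCommGroup K] [InnerProductSpace ℂ K] [CompleteSpace K],
      ¬ FiniteDimensional ℂ K → S = monotoneClass I (K →L[ℂ] K)

universe u v w

/-! The class of `A` is compared with the classes of `B(H)`, for `H` carrying an irreducible
representation `π` of `A`. From `A` to `B(H)` (`IsIrreducibleRep.monotoneClass_subset`): by a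
Kaplansky-type density argument, operators `0 ≤ x ≤ y` are strong limits of bounded nets `π a ≤ π b`
with `0 ≤ a ≤ b` in `A`. Functional calculus is strongly continuous along such nets, so `f(a) ≤
f(b)` yields `f(x) ≤ f(y)`. From all the `B(H)` back to `A`
(`mem_monotoneClass_of_forall_isIrreducibleRep`): irreducible representations detect positivity in
`A`, because extreme states do (Krein–Milman) and their GNS representations are irreducible. Between
operator algebras: monotonicity on `B(K)` descends to `B(H)` when `H` embeds in `K`
(`monotoneClass_subset_of_linearIsometry`), and finite-dimensional compressions show that `P_∞` is
contained in the class of every `B(H)` (`matrixMonotoneClassInf_subset`). -/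

open Filter Topology ContinuousLinearMap Set

/-! ### Positive elements and transfer along *-isomorphisms. -/

section Transfer

lemma mem_monotoneClass_Ici_iff {A : Type*} [Ring A] [StarRing A] [Algebra ℝ A]
    [TopologicalSpace A] [PartialOrder A] [ContinuousFunctionalCalculus ℝ A IsSelfAdjoint]
    [StarOrderedRing A] [NonnegSpectrumClass ℝ A] [StarModule ℝ A] {f : ℝ → ℝ} :
    f ∈ monotoneClass (Ici 0) A ↔
      ContinuousOn f (Ici 0) ∧ ∀ x y : A, 0 ≤ x → x ≤ y → cfc f x ≤ cfc f y := by
  refine and_congr_right fun _ ↦ ⟨fun h x y hx hxy ↦ ?_, fun h x y hx hy hsx _ hxy ↦ ?_⟩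
  · exact h x y hx.isSelfAdjoint (hx.trans hxy).isSelfAdjoint
      (fun t ht ↦ spectrum_nonneg_of_nonneg hx ht)
      (fun t ht ↦ spectrum_nonneg_of_nonneg (hx.trans hxy) ht) hxy
  · refine h x y ?_ hxy
    rw [← cfc_id ℝ x]
    exact cfc_nonneg fun t ht ↦ hsx ht

lemma monotoneClass_subset_of_starAlgEquiv {A B : Type*}
    [Ring A] [StarRing A] [Algebra ℝ A] [Algebra ℂ A] [IsScalarTower ℝ ℂ A]
    [TopologicalSpace A] [PartialOrder A] [ContinuousFunctionalCalculus ℝ A IsSelfAdjoint]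
    [StarOrderedRing A] [ContinuousMap.UniqueHom ℝ A]
    [Ring B] [StarRing B] [Algebra ℝ B] [Algebra ℂ B] [IsScalarTower ℝ ℂ B]
    [TopologicalSpace B] [PartialOrder B] [ContinuousFunctionalCalculus ℝ B IsSelfAdjoint]
    [StarOrderedRing B] [ContinuousMap.UniqueHom ℝ B]
    (I : Set ℝ) (e : A ≃⋆ₐ[ℂ] B) (he : Continuous e) :
    monotoneClass I B ⊆ monotoneClass I A := by
  rintro f ⟨hf, h⟩
  refine ⟨hf, fun x y hx hy hsx hsy hxy ↦ ?_⟩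
  have hspec (z : A) : spectrum ℝ (e z) = spectrum ℝ z :=
    AlgEquiv.spectrum_eq (e.toAlgEquiv.restrictScalars ℝ) z
  have hle := h (e x) (e y) (hx.map e) (hy.map e) (hspec x ▸ hsx) (hspec y ▸ hsy)
    (OrderHomClass.mono e hxy)
  rw [← StarAlgHomClass.map_cfc (S := ℂ) e f x (hf.mono hsx) he hx (hx.map e),
    ← StarAlgHomClass.map_cfc (S := ℂ) e f y (hf.mono hsy) he hy (hy.map e)] at hle
  simpa using OrderHomClass.mono e.symm hle

end Transfer

/-! ### Corner embeddings and comparison of operator algebras by dimension. -/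

section Compression

variable {H K : Type*} [NormedAddCommGroup H] [InnerProductSpace ℂ H] [CompleteSpace H]
  [NormedAddCommGroup K] [InnerProductSpace ℂ K] [CompleteSpace K]

/-- An isometry `V : H → K` embeds `B(H)` as a corner of `B(K)` by `T ↦ V T V*`. -/
noncomputable def LinearIsometry.cornerHom (V : H →ₗᵢ[ℂ] K) :
    (H →L[ℂ] H) →⋆ₙₐ[ℂ] (K →L[ℂ] K) where
  toFun T := V.toContinuousLinearMap ∘L T ∘L adjoint V.toContinuousLinearMap
  map_smul' c T := by ext; simp
  map_zero' := by ext; simp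
  map_add' S T := by ext; simp
  map_mul' S T := by
    ext x
    have h (z : H) : adjoint V.toContinuousLinearMap (V z) = z :=
      congr($(V.adjoint_comp_self) z)
    simp [h]
  map_star' T := by
    simp [ContinuousLinearMap.star_eq_adjoint, ContinuousLinearMap.adjoint_comp,
      ContinuousLinearMap.comp_assoc]

lemma LinearIsometry.cornerHom_apply (V : H →ₗᵢ[ℂ] K) (T : H →L[ℂ] H) :
    V.cornerHom T = V.toContinuousLinearMap ∘L T ∘L adjoint V.toContinuousLinearMap := rfl

lemma LinearIsometry.cornerHom_le_iff (V : H →ₗᵢ[ℂ] K) {S T : H →L[ℂ] H} :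
    V.cornerHom S ≤ V.cornerHom T ↔ S ≤ T := by
  refine ⟨fun h ↦ ?_, fun h ↦ OrderHomClass.mono V.cornerHom h⟩
  rw [ContinuousLinearMap.le_def, ← map_sub] at h
  rw [ContinuousLinearMap.le_def]
  convert h.adjoint_conj V.toContinuousLinearMap using 1
  ext x
  have h (z : H) : adjoint V.toContinuousLinearMap (V z) = z :=
    congr($(V.adjoint_comp_self) z)
  simp [LinearIsometry.cornerHom_apply, h]

/-- The corner embedding is not unital, so it respects only functions vanishing at `0`. Splitting
off the constant `f 0` reduces to that case, and the constant cancels in inequalities. -/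
lemma cfc_eq_cfcₙ_add_algebraMap {A : Type*} [CStarAlgebra A] [PartialOrder A] [StarOrderedRing A]
    {f : ℝ → ℝ} (hf : ContinuousOn f (Ici 0)) {x : A} (hx : 0 ≤ x) :
    cfc f x = cfcₙ (fun t ↦ f t - f 0) x + algebraMap ℝ A (f 0) := by
  have hq : ContinuousOn (fun t ↦ f t - f 0) (quasispectrum ℝ x) :=
    (hf.mono fun t ht ↦ quasispectrum_nonneg_of_nonneg x hx t ht).sub continuousOn_const
  rw [cfcₙ_eq_cfc hq (by simp), ← cfc_add_const (f 0) _ x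
    (hq.mono (spectrum_subset_quasispectrum ℝ x)) hx.isSelfAdjoint]
  simp

lemma cfc_le_cfc_iff_cfcₙ {A : Type*} [CStarAlgebra A] [PartialOrder A] [StarOrderedRing A]
    {f : ℝ → ℝ} (hf : ContinuousOn f (Ici 0)) {x y : A} (hx : 0 ≤ x) (hy : 0 ≤ y) :
    cfc f x ≤ cfc f y ↔ cfcₙ (fun t ↦ f t - f 0) x ≤ cfcₙ (fun t ↦ f t - f 0) y := by
  rw [cfc_eq_cfcₙ_add_algebraMap hf hx, cfc_eq_cfcₙ_add_algebraMap hf hy, add_le_add_iff_right]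

lemma LinearIsometry.cfc_cornerHom_le_iff (V : H →ₗᵢ[ℂ] K) {f : ℝ → ℝ}
    (hf : ContinuousOn f (Ici 0)) {x y : H →L[ℂ] H} (hx : 0 ≤ x) (hy : 0 ≤ y) :
    cfc f (V.cornerHom x) ≤ cfc f (V.cornerHom y) ↔ cfc f x ≤ cfc f y := by
  have hV {z : H →L[ℂ] H} (hz : 0 ≤ z) : 0 ≤ V.cornerHom z := map_nonneg V.cornerHom hz
  have hmap {z : H →L[ℂ] H} (hz : 0 ≤ z) :
      V.cornerHom (cfcₙ (fun t ↦ f t - f 0) z) = cfcₙ (fun t ↦ f t - f 0) (V.cornerHom z) :=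
    NonUnitalStarAlgHom.map_cfcₙ _ _ _
      ((hf.mono fun t ht ↦ quasispectrum_nonneg_of_nonneg z hz t ht).sub continuousOn_const)
      (by simp) (map_continuous V.cornerHom) hz.isSelfAdjoint (hV hz).isSelfAdjoint
  rw [cfc_le_cfc_iff_cfcₙ hf (hV hx) (hV hy), cfc_le_cfc_iff_cfcₙ hf hx hy, ← hmap hx, ← hmap hy,
    V.cornerHom_le_iff]

/-- Monotonicity on `B(K)` passes to `B(H)` when `H` embeds isometrically into `K`. -/
lemma monotoneClass_subset_of_linearIsometry (V : H →ₗᵢ[ℂ] K) :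
    monotoneClass (Ici 0) (K →L[ℂ] K) ⊆ monotoneClass (Ici 0) (H →L[ℂ] H) := by
  intro f hf
  rw [mem_monotoneClass_Ici_iff] at hf ⊢
  refine ⟨hf.1, fun x y hx hxy ↦ ?_⟩
  rw [← V.cfc_cornerHom_le_iff hf.1 hx (hx.trans hxy)]
  exact hf.2 _ _ (map_nonneg V.cornerHom hx) (V.cornerHom_le_iff.2 hxy)

lemma matrixMonotoneClass_eq (I : Set ℝ) (n : ℕ) :
    matrixMonotoneClass I n =
      monotoneClass I (EuclideanSpace ℂ (Fin n) →L[ℂ] EuclideanSpace ℂ (Fin n)) := by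
  let e := Matrix.toEuclideanCLM (𝕜 := ℂ) (n := Fin n)
  refine Subset.antisymm ?_ ?_
  · exact monotoneClass_subset_of_starAlgEquiv I e.symm
      (LinearMap.continuous_of_finiteDimensional e.symm.toAlgEquiv.toLinearMap)
  · exact monotoneClass_subset_of_starAlgEquiv I e
      (LinearMap.continuous_of_finiteDimensional e.toAlgEquiv.toLinearMap)

lemma exists_linearIsometry_of_finrank_le {H K : Type*} [NormedAddCommGroup H]
    [InnerProductSpace ℂ H] [NormedAddCommGroup K] [InnerProductSpace ℂ K]
    [FiniteDimensional ℂ H] [FiniteDimensional ℂ K]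
    (h : Module.finrank ℂ H ≤ Module.finrank ℂ K) : Nonempty (H →ₗᵢ[ℂ] K) := by
  let b := stdOrthonormalBasis ℂ H
  let c := stdOrthonormalBasis ℂ K
  have hc : Orthonormal ℂ (c ∘ Fin.castLE h) :=
    c.orthonormal.comp _ (Fin.castLE_injective h)
  refine ⟨(b.toBasis.constr ℂ (c ∘ Fin.castLE h)).isometryOfOrthonormal
    (v := b.toBasis) (by simp) ?_⟩
  convert hc using 1
  ext i
  simp

lemma matrixMonotoneClass_subset_of_finrank_le [FiniteDimensional ℂ H] {n : ℕ}
    (h : Module.finrank ℂ H ≤ n) :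
    matrixMonotoneClass (Ici 0) n ⊆ monotoneClass (Ici 0) (H →L[ℂ] H) := by
  rw [matrixMonotoneClass_eq]
  obtain ⟨V⟩ := exists_linearIsometry_of_finrank_le (H := H) (K := EuclideanSpace ℂ (Fin n))
    (by simpa using h)
  exact monotoneClass_subset_of_linearIsometry V

lemma subset_matrixMonotoneClass_of_le_finrank [FiniteDimensional ℂ H] {n : ℕ}
    (h : n ≤ Module.finrank ℂ H) :
    monotoneClass (Ici 0) (H →L[ℂ] H) ⊆ matrixMonotoneClass (Ici 0) n := by
  rw [matrixMonotoneClass_eq]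
  obtain ⟨V⟩ := exists_linearIsometry_of_finrank_le (H := EuclideanSpace ℂ (Fin n)) (K := H)
    (by simpa using h)
  exact monotoneClass_subset_of_linearIsometry V

lemma subset_matrixMonotoneClassInf_of_infinite (h : ¬ FiniteDimensional ℂ H) :
    monotoneClass (Ici 0) (H →L[ℂ] H) ⊆ matrixMonotoneClassInf (Ici 0) := by
  refine subset_iInter₂ fun n _ ↦ ?_
  obtain ⟨F, hF, hn⟩ : ∃ F : Submodule ℂ H, FiniteDimensional ℂ F ∧ Module.finrank ℂ F = n := by
    have hrank : (n : Cardinal) ≤ Module.rank ℂ H := by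
      have : Cardinal.aleph0 ≤ Module.rank ℂ H := by
        rwa [← not_lt, Module.rank_lt_aleph0_iff]
      exact (Cardinal.natCast_lt_aleph0.le).trans this
    obtain ⟨s, hs, hli⟩ := le_rank_iff_exists_linearIndependent_finset.1 hrank
    refine ⟨Submodule.span ℂ s, inferInstance, ?_⟩
    rw [finrank_span_finset_eq_card hli, hs]
  exact (monotoneClass_subset_of_linearIsometry F.subtypeₗᵢ).trans
    (subset_matrixMonotoneClass_of_le_finrank hn.ge)

end Compression

/-! ### Order and functional calculus under strong limits. -/

section StrongLimits

variable {ι H : Type*} [NormedAddCommGroup H] [InnerProductSpace ℂ H]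

/-- Write `T i (u i) = T i (u i - v) + T i v`; the uniform bound kills the first term. This makes
products, hence polynomials, strongly continuous on bounded sets. -/
lemma tendsto_apply_of_bounded {l : Filter ι} {T : ι → H →L[ℂ] H} {S : H →L[ℂ] H} {M : ℝ}
    (hT : ∀ i, ‖T i‖ ≤ M) (h : ∀ ξ, Tendsto (fun i ↦ T i ξ) l (𝓝 (S ξ)))
    {u : ι → H} {v : H} (hu : Tendsto u l (𝓝 v)) :
    Tendsto (fun i ↦ T i (u i)) l (𝓝 (S v)) := by
  have h0 : Tendsto (fun i ↦ T i (u i - v)) l (𝓝 0) := by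
    refine squeeze_zero_norm (fun i ↦ ((T i).le_of_opNorm_le (hT i) _)) ?_
    simpa using ((tendsto_sub_nhds_zero_iff.2 hu).norm.const_mul M)
  simpa using h0.add (h v)

lemma tendsto_aeval_apply {l : Filter ι} {T : ι → H →L[ℂ] H} {S : H →L[ℂ] H} {M : ℝ}
    (hT : ∀ i, ‖T i‖ ≤ M) (h : ∀ ξ, Tendsto (fun i ↦ T i ξ) l (𝓝 (S ξ)))
    (p : Polynomial ℝ) (ξ : H) :
    Tendsto (fun i ↦ Polynomial.aeval (T i) p ξ) l (𝓝 (Polynomial.aeval S p ξ)) := by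
  induction p using Polynomial.induction_on with
  | C a => simp [Polynomial.aeval_C, Algebra.algebraMap_eq_smul_one, tendsto_const_nhds]
  | add p q hp hq => simpa using hp.add hq
  | monomial n a ih =>
    have := tendsto_apply_of_bounded hT h ih
    simpa [pow_succ', mul_left_comm, Algebra.algebraMap_eq_smul_one] using this

lemma le_of_tendsto_apply {l : Filter ι} [l.NeBot] {T T' : ι → H →L[ℂ] H} {S S' : H →L[ℂ] H}
    (h : ∀ ξ, Tendsto (fun i ↦ T i ξ) l (𝓝 (S ξ)))
    (h' : ∀ ξ, Tendsto (fun i ↦ T' i ξ) l (𝓝 (S' ξ))) (hle : ∀ i, T i ≤ T' i) : S ≤ S' := by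
  simp only [ContinuousLinearMap.le_def, ContinuousLinearMap.isPositive_iff_complex] at hle ⊢
  intro ξ
  have hlim : Tendsto (fun i ↦ inner ℂ ((T' i - T i) ξ) ξ) l (𝓝 (inner ℂ ((S' - S) ξ) ξ)) :=
    ((h' ξ).sub (h ξ)).inner (𝕜 := ℂ) tendsto_const_nhds
  have hcl : IsClosed {z : ℂ | ((RCLike.re z : ℝ) : ℂ) = z ∧ 0 ≤ RCLike.re z} :=
    (isClosed_eq (Complex.continuous_ofReal.comp Complex.continuous_re) continuous_id).inter
      (isClosed_le continuous_const Complex.continuous_re)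
  exact hcl.mem_of_tendsto hlim (Eventually.of_forall fun i ↦ hle i ξ)

variable [CompleteSpace H]

/-- Continuous functional calculus is continuous along bounded strongly convergent nets of positive
operators. -/
lemma tendsto_cfc_apply {l : Filter ι} {T : ι → H →L[ℂ] H} {S : H →L[ℂ] H} {M : ℝ}
    (hT0 : ∀ i, 0 ≤ T i) (hT : ∀ i, ‖T i‖ ≤ M) (hS0 : 0 ≤ S) (hS : ‖S‖ ≤ M)
    (h : ∀ ξ, Tendsto (fun i ↦ T i ξ) l (𝓝 (S ξ))) {f : ℝ → ℝ} (hf : ContinuousOn f (Ici 0))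
    (ξ : H) :
    Tendsto (fun i ↦ cfc f (T i) ξ) l (𝓝 (cfc f S ξ)) := by
  -- Weierstrass approximation: a polynomial uniformly close to `f` on `[0, M]` gives operators
  -- close in norm, at the same rate for every `R` in the net and for its limit.
  have approx {ε : ℝ} (hε : 0 < ε) {p : Polynomial ℝ}
      (hp : ∀ x ∈ Icc 0 M, |p.eval x - f x| < ε) {R : H →L[ℂ] H} (hR0 : 0 ≤ R) (hR : ‖R‖ ≤ M) :
      ‖Polynomial.aeval R p ξ - cfc f R ξ‖ ≤ ε * ‖ξ‖ := by
    rw [← cfc_polynomial p R hR0.isSelfAdjoint, ← sub_apply,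
      ← cfc_sub _ _ R (by fun_prop) (hf.mono fun t ht ↦ spectrum_nonneg_of_nonneg hR0 ht)]
    refine ContinuousLinearMap.le_of_opNorm_le _ (norm_cfc_le hε.le fun t ht ↦ (hp t ⟨?_, ?_⟩).le) _
    · exact spectrum_nonneg_of_nonneg hR0 ht
    · have : Nontrivial (H →L[ℂ] H) := by
        by_contra hn
        rw [not_nontrivial_iff_subsingleton] at hn
        simp at ht
      exact (le_abs_self t).trans ((spectrum.norm_le_norm_of_mem ht).trans hR)
  rw [Metric.tendsto_nhds]
  intro ε hε
  set δ := ε / (3 * (‖ξ‖ + 1)) with hδ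
  have hδ0 : 0 < δ := by positivity
  have hδξ : δ * ‖ξ‖ ≤ ε / 3 := by
    rw [hδ, div_mul_eq_mul_div, div_le_div_iff₀ (by positivity) (by norm_num)]
    nlinarith [norm_nonneg ξ]
  obtain ⟨p, hp⟩ := exists_polynomial_near_of_continuousOn 0 M f
    (hf.mono Icc_subset_Ici_self) δ hδ0
  filter_upwards [Metric.tendsto_nhds.1 (tendsto_aeval_apply hT h p ξ) (ε / 3) (by positivity)]
    with i hi
  have h1 := approx hδ0 hp (hT0 i) (hT i)
  have h2 := approx hδ0 hp hS0 hS
  rw [dist_eq_norm] at hi ⊢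
  rw [norm_sub_rev] at h1
  calc ‖cfc f (T i) ξ - cfc f S ξ‖
      = ‖(cfc f (T i) ξ - Polynomial.aeval (T i) p ξ)
          + (Polynomial.aeval (T i) p ξ - Polynomial.aeval S p ξ)
          + (Polynomial.aeval S p ξ - cfc f S ξ)‖ := by congr 1; abel
    _ ≤ _ := norm_add₃_le
    _ < ε := by linarith

end StrongLimits

/-! ### From matrices to arbitrary Hilbert spaces. -/

section Finite

variable {H : Type*} [NormedAddCommGroup H] [InnerProductSpace ℂ H] [CompleteSpace H]

/-- `p T p`, with `p` the projection onto `F`, is the compression of `T` to `F` extended by zero. -/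
lemma starProjection_conj_eq_cornerHom (F : Submodule ℂ H) [FiniteDimensional ℂ F] (T : H →L[ℂ] H) :
    F.starProjection * T * F.starProjection =
      F.subtypeₗᵢ.cornerHom (F.orthogonalProjectionOnto ∘L T ∘L F.subtypeL) := by
  have h : adjoint F.subtypeₗᵢ.toContinuousLinearMap = F.orthogonalProjectionOnto :=
    F.adjoint_subtypeL
  rw [LinearIsometry.cornerHom_apply, h]
  rfl

/-- Compress `x ≤ y` to the spans of finite sets of vectors, ordered by inclusion. The compressions
stay ordered and bounded and converge strongly to `x` and `y`. -/
lemma matrixMonotoneClassInf_subset :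
    matrixMonotoneClassInf (Ici 0) ⊆ monotoneClass (Ici 0) (H →L[ℂ] H) := by
  intro f hf
  -- Order `finrank + 1` is used because the zero subspace would ask for `P_0`, which is not in the
  -- intersection.
  have hfin (F : Submodule ℂ H) [FiniteDimensional ℂ F] :=
    matrixMonotoneClass_subset_of_finrank_le (H := F) (Nat.le_succ (Module.finrank ℂ F))
      (mem_iInter₂.1 hf _ (Nat.le_add_left 1 _))
  have hcont : ContinuousOn f (Ici 0) := (mem_iInter₂.1 hf 1 le_rfl).1
  rw [mem_monotoneClass_Ici_iff]
  refine ⟨hcont, fun x y hx hxy ↦ ?_⟩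
  have hy := hx.trans hxy
  let F (s : Finset H) : Submodule ℂ H := Submodule.span ℂ s
  let c (s : Finset H) (T : H →L[ℂ] H) : H →L[ℂ] H := (F s).starProjection * T * (F s).starProjection
  have hP (s : Finset H) : ‖(F s).starProjection‖ ≤ 1 := (F s).starProjection_norm_le
  have hPlim (ξ : H) : Tendsto (fun s ↦ (F s).starProjection ξ) atTop (𝓝 ξ) := by
    refine tendsto_const_nhds.congr' ?_
    filter_upwards [eventually_ge_atTop {ξ}] with s hs
    exact (Submodule.starProjection_eq_self_iff.2 (Submodule.subset_span (by simpa using hs))).symm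
  have hnorm (T : H →L[ℂ] H) (s : Finset H) : ‖c s T‖ ≤ ‖T‖ := by
    calc ‖c s T‖ ≤ ‖(F s).starProjection‖ * ‖T‖ * ‖(F s).starProjection‖ := norm_mul₃_le
      _ ≤ 1 * ‖T‖ * 1 := by gcongr <;> exact hP s
      _ = ‖T‖ := by ring
  have hlim (T : H →L[ℂ] H) (ξ : H) : Tendsto (fun s ↦ c s T ξ) atTop (𝓝 (T ξ)) :=
    tendsto_apply_of_bounded (S := 1) hP hPlim ((T.continuous.tendsto ξ).comp (hPlim ξ))
  have hmono (s : Finset H) {S T : H →L[ℂ] H} (hST : S ≤ T) :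
      (F s).orthogonalProjectionOnto ∘L S ∘L (F s).subtypeL ≤
        (F s).orthogonalProjectionOnto ∘L T ∘L (F s).subtypeL := by
    rw [← (F s).subtypeₗᵢ.cornerHom_le_iff, ← starProjection_conj_eq_cornerHom,
      ← starProjection_conj_eq_cornerHom]
    exact IsSelfAdjoint.conjugate_le_conjugate hST (isSelfAdjoint_starProjection _)
  have hnn (s : Finset H) {T : H →L[ℂ] H} (hT : 0 ≤ T) :
      0 ≤ (F s).orthogonalProjectionOnto ∘L T ∘L (F s).subtypeL := by
    simpa using hmono s hT
  have hc0 {T : H →L[ℂ] H} (hT : 0 ≤ T) (s : Finset H) : 0 ≤ c s T := by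
    simp only [c]
    rw [starProjection_conj_eq_cornerHom]
    exact map_nonneg _ (hnn s hT)
  refine le_of_tendsto_apply
    (tendsto_cfc_apply (hc0 hx) (hnorm x) hx le_rfl (hlim x) hcont)
    (tendsto_cfc_apply (hc0 hy) (hnorm y) hy le_rfl (hlim y) hcont) fun s ↦ ?_
  simp only [c]
  rw [starProjection_conj_eq_cornerHom, starProjection_conj_eq_cornerHom,
    LinearIsometry.cfc_cornerHom_le_iff _ hcont (hnn s hx) (hnn s hy)]
  exact (mem_monotoneClass_Ici_iff.1 (hfin (F s))).2 _ _ (hnn s hx) (hmono s hxy)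

end Finite

/-! ### Schur's lemma and a bicommutant argument. -/

section Irreducible

/-- Invariance under the adjoint `T'` makes `T` preserve `Kᗮ`, so `T v = T (P v) + T (v - P v)` is
the orthogonal decomposition of `T v`. -/
lemma starProjection_apply_eq_of_invariant {E : Type*} [NormedAddCommGroup E]
    [InnerProductSpace ℂ E] {K : Submodule ℂ E} [K.HasOrthogonalProjection] {T T' : E →L[ℂ] E}
    (hadj : ∀ v w, inner ℂ v (T w) = inner ℂ (T' v) w) (hT : ∀ v ∈ K, T v ∈ K)
    (hT' : ∀ v ∈ K, T' v ∈ K) (v : E) : K.starProjection (T v) = T (K.starProjection v) := by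
  refine Submodule.eq_starProjection_of_mem_orthogonal (hT _ (K.starProjection_apply_mem v)) ?_
  rw [← map_sub, Submodule.mem_orthogonal]
  intro u hu
  rw [hadj]
  exact Submodule.inner_right_of_mem_orthogonal (hT' u hu) (K.sub_starProjection_mem_orthogonal v)

variable {A H : Type*} [CStarAlgebra A] [NormedAddCommGroup H] [InnerProductSpace ℂ H]

/-- The diagonal action of an operator on a finite power of `H`. -/
noncomputable def diagCLM (ι : Type*) [Fintype ι] (T : H →L[ℂ] H) :
    PiLp 2 (fun _ : ι ↦ H) →L[ℂ] PiLp 2 (fun _ : ι ↦ H) :=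
  (PiLp.continuousLinearEquiv 2 ℂ (fun _ : ι ↦ H)).symm.toContinuousLinearMap ∘L
    ContinuousLinearMap.pi fun i ↦ T ∘L PiLp.proj 2 (fun _ : ι ↦ H) i

@[simp]
lemma diagCLM_apply {ι : Type*} [Fintype ι] (T : H →L[ℂ] H) (v : PiLp 2 (fun _ : ι ↦ H)) (i : ι) :
    diagCLM ι T v i = T (v i) := rfl

variable [CompleteSpace H] {π : A →⋆ₐ[ℂ] (H →L[ℂ] H)}

/-- The kernel of `S` is closed and invariant, and it contains the range of `R`. -/
lemma IsIrreducibleRep.eq_zero_or_eq_zero (hπ : IsIrreducibleRep π) {S R : H →L[ℂ] H}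
    (hS : ∀ a, Commute S (π a)) (hSR : S * R = 0) : S = 0 ∨ R = 0 := by
  have hinv (a : A) (v : H) (hv : v ∈ LinearMap.ker (S : H →ₗ[ℂ] H)) :
      π a v ∈ LinearMap.ker (S : H →ₗ[ℂ] H) := by
    have hv' : S v = 0 := hv
    have := congr($((hS a).eq) v)
    simpa [hv'] using this
  rcases hπ.2 _ S.isClosed_ker hinv with h | h
  · right
    ext v
    have : R v ∈ LinearMap.ker (S : H →ₗ[ℂ] H) := congr($hSR v)
    simpa [h] using this
  · left
    ext v
    have : v ∈ LinearMap.ker (S : H →ₗ[ℂ] H) := h ▸ Submodule.mem_top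
    simpa using this

/-- Two distinct spectral points would give two nonzero functions of `T` with product zero, both
commuting with `π`. -/
lemma IsIrreducibleRep.exists_eq_algebraMap_of_isSelfAdjoint (hπ : IsIrreducibleRep π)
    {T : H →L[ℂ] H} (hT : IsSelfAdjoint T) (hcomm : ∀ a, Commute T (π a)) :
    ∃ r : ℝ, T = algebraMap ℝ (H →L[ℂ] H) r := by
  have := hπ.1
  obtain ⟨s, hs⟩ := ContinuousFunctionalCalculus.spectrum_nonempty (R := ℝ) T hT
  refine ⟨s, ?_⟩
  by_cases hall : ∀ t ∈ spectrum ℝ T, t = s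
  · conv_lhs => rw [← cfc_id' ℝ T]
    rw [cfc_congr (g := fun _ ↦ s) hall, cfc_const s T]
  push Not at hall
  obtain ⟨t, ht, hts⟩ := hall
  have key (f g : ℝ → ℝ) (hf : Continuous f) (hg : Continuous g) (hfg : ∀ x, f x * g x = 0)
      (hfs : f s ≠ 0) (hgt : g t ≠ 0) : False := by
    have hprod : cfc f T * cfc g T = 0 := by
      rw [← cfc_mul f g T hf.continuousOn hg.continuousOn]
      simp [hfg]
    have hne {f : ℝ → ℝ} (hf : Continuous f) {s : ℝ} (hs : s ∈ spectrum ℝ T) (h : f s ≠ 0) :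
        cfc f T ≠ 0 := fun h0 ↦ h <| by
      simpa [h0] using norm_apply_le_norm_cfc f T hs hf.continuousOn hT
    rcases hπ.eq_zero_or_eq_zero (fun a ↦ (hcomm a).cfc (by rw [hT.star_eq]; exact hcomm a) f)
      hprod with h | h
    · exact hne hf hs hfs h
    · exact hne hg ht hgt h
  exfalso
  -- The two functions live on opposite sides of the midpoint of `s` and `t`; the factor `t - s`
  -- covers both orderings.
  refine key (fun x ↦ max 0 ((t - s) * ((s + t) / 2 - x)))
    (fun x ↦ max 0 ((t - s) * (x - (s + t) / 2)))
    (by fun_prop) (by fun_prop) (fun x ↦ ?_) ?_ ?_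
  · rcases le_total 0 ((t - s) * (x - (s + t) / 2)) with h | h
    · rw [max_eq_left (a := (0 : ℝ)) (by linarith), zero_mul]
    · rw [max_eq_left h, mul_zero]
  all_goals
    refine (lt_max_of_lt_right ?_).ne'
    have : 0 < (t - s) ^ 2 := by positivity [sub_ne_zero.2 hts]
    nlinarith

/-- Schur's lemma: the commutant of an irreducible representation consists of scalars. -/
lemma IsIrreducibleRep.exists_eq_algebraMap (hπ : IsIrreducibleRep π)
    {T : H →L[ℂ] H} (hcomm : ∀ a, Commute T (π a)) :
    ∃ c : ℂ, T = algebraMap ℂ (H →L[ℂ] H) c := by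
  have hstar (a : A) : Commute (star T) (π a) := by
    simpa [map_star] using (hcomm (star a)).star_star
  have hre (a : A) : Commute (realPart T : H →L[ℂ] H) (π a) := by
    rw [realPart_apply_coe]
    exact ((hcomm a).add_left (hstar a)).smul_left _
  have him (a : A) : Commute (imaginaryPart T : H →L[ℂ] H) (π a) := by
    rw [imaginaryPart_apply_coe]
    exact (((hcomm a).sub_left (hstar a)).smul_left _).smul_left _
  obtain ⟨r, hr⟩ := hπ.exists_eq_algebraMap_of_isSelfAdjoint (realPart T).2 hre
  obtain ⟨s, hs⟩ := hπ.exists_eq_algebraMap_of_isSelfAdjoint (imaginaryPart T).2 him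
  refine ⟨r + Complex.I * s, ?_⟩
  rw [← realPart_add_I_smul_imaginaryPart T, hr, hs]
  ext v
  simp [Algebra.algebraMap_eq_smul_one, add_smul, mul_smul]

/-- The matrix entries of `P` commute with `π`, so they are scalars by Schur's lemma, and a scalar
matrix commutes with every diagonal operator. -/
lemma IsIrreducibleRep.diagCLM_commute (hπ : IsIrreducibleRep π) {ι : Type*} [Fintype ι]
    {P : PiLp 2 (fun _ : ι ↦ H) →L[ℂ] PiLp 2 (fun _ : ι ↦ H)}
    (hP : ∀ a v, P (diagCLM ι (π a) v) = diagCLM ι (π a) (P v))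
    (T : H →L[ℂ] H) (v : PiLp 2 (fun _ : ι ↦ H)) :
    P (diagCLM ι T v) = diagCLM ι T (P v) := by
  classical
  let single (j : ι) : H →L[ℂ] PiLp 2 (fun _ : ι ↦ H) :=
    (PiLp.continuousLinearEquiv 2 ℂ (fun _ : ι ↦ H)).symm.toContinuousLinearMap ∘L
      ContinuousLinearMap.single ℂ (fun _ : ι ↦ H) j
  have hsingle (S : H →L[ℂ] H) (j : ι) (x : H) :
      single j (S x) = diagCLM ι S (single j x) := by
    ext i
    by_cases h : i = j
    · subst h; simp [single]
    · simp [single, h]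
  have hsum (v : PiLp 2 (fun _ : ι ↦ H)) : v = ∑ j, single j (v j) := by
    ext i
    simp [single, Pi.single_apply, WithLp.ofLp_sum]
  let Q (i j : ι) : H →L[ℂ] H := PiLp.proj 2 (fun _ : ι ↦ H) i ∘L P ∘L single j
  have hQ (i j : ι) : ∃ c : ℂ, Q i j = algebraMap ℂ (H →L[ℂ] H) c := by
    refine hπ.exists_eq_algebraMap fun a ↦ ?_
    ext x
    simp [Q, hsingle, hP]
  have hQT (i j : ι) (x : H) : P (single j (T x)) i = T (P (single j x) i) := by
    obtain ⟨c, hc⟩ := hQ i j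
    have h (x : H) : P (single j x) i = c • x := by
      have := congr($hc x)
      simpa [Q, Algebra.algebraMap_eq_smul_one] using this
    simp [h]
  ext i
  conv_lhs => rw [hsum (diagCLM ι T v)]
  conv_rhs => rw [hsum v]
  simp [hQT, WithLp.ofLp_sum, Finset.sum_apply]

/-- A normal functional of finite rank vanishing on the image of an irreducible representation
vanishes identically. -/
lemma IsIrreducibleRep.sum_inner_eq_zero (hπ : IsIrreducibleRep π) {ι : Type*} [Fintype ι]
    {ξ η : ι → H} (h : ∀ a, ∑ i, inner ℂ (η i) (π a (ξ i)) = 0) (T : H →L[ℂ] H) :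
    ∑ i, inner ℂ (η i) (T (ξ i)) = 0 := by
  let ξ' : PiLp 2 (fun _ : ι ↦ H) := WithLp.toLp 2 ξ
  let η' : PiLp 2 (fun _ : ι ↦ H) := WithLp.toLp 2 η
  let L : A →ₗ[ℂ] PiLp 2 (fun _ : ι ↦ H) :=
    { toFun a := diagCLM ι (π a) ξ'
      map_add' a b := by ext; simp
      map_smul' c a := by ext; simp }
  -- The projection onto the cyclic subspace `M` of `ξ'` commutes with the diagonal action of `π`,
  -- hence with that of `T`. So `T` keeps `ξ'` in `M`, while `η'` is orthogonal to `M`.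
  let M : Submodule ℂ (PiLp 2 (fun _ : ι ↦ H)) := (LinearMap.range L).topologicalClosure
  have hMc : IsClosed (M : Set (PiLp 2 (fun _ : ι ↦ H))) := Submodule.isClosed_topologicalClosure _
  have : CompleteSpace M := hMc.completeSpace_coe
  have hLM (a : A) : L a ∈ M := Submodule.le_topologicalClosure _ ⟨a, rfl⟩
  have hinv (a : A) {v : PiLp 2 (fun _ : ι ↦ H)} (hv : v ∈ M) : diagCLM ι (π a) v ∈ M := by
    refine closure_minimal (t := (diagCLM ι (π a)) ⁻¹' (M : Set (PiLp 2 (fun _ : ι ↦ H)))) ?_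
      (hMc.preimage (diagCLM ι (π a)).continuous) hv
    rintro _ ⟨b, rfl⟩
    have : diagCLM ι (π a) (L b) = L (a * b) := by ext; simp [L]
    rw [mem_preimage, this]
    exact hLM _
  have hadj (a : A) (v w : PiLp 2 (fun _ : ι ↦ H)) :
      inner ℂ v (diagCLM ι (π a) w) = inner ℂ (diagCLM ι (π (star a)) v) w := by
    simp only [PiLp.inner_apply, diagCLM_apply, map_star, ContinuousLinearMap.star_eq_adjoint,
      ContinuousLinearMap.adjoint_inner_left]
  have hcomm (a : A) (v : PiLp 2 (fun _ : ι ↦ H)) :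
      M.starProjection (diagCLM ι (π a) v) = diagCLM ι (π a) (M.starProjection v) :=
    starProjection_apply_eq_of_invariant (hadj a) (fun _ hv ↦ hinv a hv)
      (fun _ hv ↦ hinv (star a) hv) v
  have hξ : ξ' ∈ M := by
    have : L 1 = ξ' := by ext; simp [L]
    exact this ▸ hLM 1
  have hT : diagCLM ι T ξ' ∈ M := by
    rw [← Submodule.starProjection_eq_self_iff, hπ.diagCLM_commute hcomm,
      Submodule.starProjection_eq_self_iff.2 hξ]
  have horth : M ≤ (ℂ ∙ η')ᗮ := by
    refine Submodule.topologicalClosure_minimal _ ?_ (Submodule.isClosed_orthogonal _)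
    rintro _ ⟨a, rfl⟩
    rw [Submodule.mem_orthogonal_singleton_iff_inner_right, PiLp.inner_apply]
    exact h a
  simpa [PiLp.inner_apply, ξ', η'] using
    Submodule.mem_orthogonal_singleton_iff_inner_right.1 (horth hT)

end Irreducible

/-! ### Strong density of the self-adjoint part. -/

section Density

variable {A H : Type*} [CStarAlgebra A] [NormedAddCommGroup H] [InnerProductSpace ℂ H]
  [CompleteSpace H] {π : A →⋆ₐ[ℂ] (H →L[ℂ] H)}

lemma exists_sum_inner_eq {ι : Type*} [Fintype ι] (f : (ι → H) →L[ℂ] ℂ) :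
    ∃ η : ι → H, ∀ w, f w = ∑ i, inner ℂ (η i) (w i) := by
  classical
  refine ⟨fun i ↦ (InnerProductSpace.toDual ℂ H).symm
    (f ∘L ContinuousLinearMap.single ℂ (fun _ : ι ↦ H) i), fun w ↦ ?_⟩
  conv_lhs => rw [← Finset.univ_sum_single w, map_sum]
  simp

/-- Otherwise a real-linear separation gives `f` whose real part vanishes on the image of the
self-adjoint part but not at `T`. Symmetrising `f` turns this into a complex-linear condition to
which `sum_inner_eq_zero` applies. -/
lemma IsIrreducibleRep.mem_closure_range_selfAdjoint (hπ : IsIrreducibleRep π) {ι : Type*}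
    [Fintype ι] (ξ : ι → H) {T : H →L[ℂ] H} (hT : IsSelfAdjoint T) :
    (fun i ↦ T (ξ i)) ∈ closure (range fun (c : selfAdjoint A) i ↦ π c (ξ i)) := by
  let Φ : selfAdjoint A →ₗ[ℝ] (ι → H) :=
    { toFun c i := π c (ξ i)
      map_add' c d := by ext; simp
      map_smul' r c := by
        ext i
        have : π (r • (c : A)) = r • π (c : A) := by
          rw [← Complex.coe_smul, map_smul, Complex.coe_smul]
        simp [this] }
  change _ ∈ closure (range Φ)
  by_contra hmem
  obtain ⟨f, u, hfu, hux⟩ := RCLike.geometric_hahn_banach_closed_point (𝕜 := ℂ)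
    ((LinearMap.range Φ).convex.closure) isClosed_closure hmem
  have hu : 0 < u := by simpa using hfu 0 (subset_closure ⟨0, map_zero Φ⟩)
  have hre (c : selfAdjoint A) : (f (Φ c)).re = 0 := by
    have hlt (t : ℝ) : t * (f (Φ c)).re < u := by
      have := hfu (Φ (t • c)) (subset_closure ⟨_, rfl⟩)
      rwa [map_smul, ← Complex.coe_smul, map_smul, smul_eq_mul, RCLike.re_eq_complex_re,
        Complex.re_ofReal_mul] at this
    by_contra h0
    have := hlt (u / (f (Φ c)).re)
    rw [div_mul_cancel₀ _ h0] at this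
    exact this.false
  obtain ⟨η, hη⟩ := exists_sum_inner_eq f
  -- Over the doubled index set, the functional adds `⟨ξ, S η⟩` to `⟨η, S ξ⟩`; for self-adjoint `S`
  -- these are conjugate, so only twice the real part is left.
  have hsa {S : H →L[ℂ] H} (hS : IsSelfAdjoint S) :
      ∑ k : ι ⊕ ι, inner ℂ (Sum.elim η ξ k) (S (Sum.elim ξ η k)) =
        ((2 * (f fun i ↦ S (ξ i)).re : ℝ) : ℂ) := by
    have hsymm (x y : H) : inner ℂ x (S y) = starRingEnd ℂ (inner ℂ y (S x)) := by
      rw [inner_conj_symm, ← ContinuousLinearMap.adjoint_inner_left,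
        ← ContinuousLinearMap.star_eq_adjoint, hS.star_eq]
    rw [Fintype.sum_sum_type, hη, ← Complex.add_conj, map_sum]
    simp only [Sum.elim_inl, Sum.elim_inr]
    congr 1
    exact Finset.sum_congr rfl fun i _ ↦ hsymm _ _
  have hall (a : A) : ∑ k : ι ⊕ ι, inner ℂ (Sum.elim η ξ k) (π a (Sum.elim ξ η k)) = 0 := by
    have h0 (c : selfAdjoint A) :
        ∑ k : ι ⊕ ι, inner ℂ (Sum.elim η ξ k) (π c (Sum.elim ξ η k)) = 0 := by
      rw [hsa (c.2.map π)]
      have := hre c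
      simp only [Φ, LinearMap.coe_mk, AddHom.coe_mk] at this
      simp [this]
    rw [← realPart_add_I_smul_imaginaryPart a]
    simp only [map_add, map_smul, add_apply, smul_apply, inner_add_right, inner_smul_right,
      Finset.sum_add_distrib, ← Finset.mul_sum, h0]
    simp
  have := hsa hT
  rw [hπ.sum_inner_eq_zero hall T] at this
  have h2 : (f fun i ↦ T (ξ i)).re = 0 := by
    have := Complex.ofReal_eq_zero.1 this.symm
    linarith
  rw [RCLike.re_eq_complex_re, h2] at hux
  exact hu.not_gt hux

/-- The self-adjoint part of an irreducible representation is strongly dense in the self-adjoint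
operators. -/
lemma IsIrreducibleRep.exists_filter_selfAdjoint (hπ : IsIrreducibleRep π) {T : H →L[ℂ] H}
    (hT : IsSelfAdjoint T) :
    ∃ l : Filter (selfAdjoint A), l.NeBot ∧
      ∀ ξ, Tendsto (fun c : selfAdjoint A ↦ π c ξ) l (𝓝 (T ξ)) := by
  -- Strong convergence is convergence in the product `H → H`, whose basic neighbourhoods constrain
  -- only finitely many vectors.
  let Φ : selfAdjoint A → H → H := fun c ξ ↦ π c ξ
  refine ⟨comap Φ (𝓝 T), ?_, fun ξ ↦ ?_⟩
  · rw [comap_neBot_iff]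
    intro U hU
    rw [nhds_pi, Filter.mem_pi] at hU
    obtain ⟨I, hI, t, ht, hIU⟩ := hU
    have := hI.fintype
    obtain ⟨_, hw, c, rfl⟩ := mem_closure_iff_nhds.1
      (hπ.mem_closure_range_selfAdjoint (fun ξ : I ↦ (ξ : H)) hT) (univ.pi fun ξ : I ↦ t ξ)
      (set_pi_mem_nhds finite_univ fun ξ _ ↦ ht ξ)
    exact ⟨c, hIU fun ξ hξ ↦ hw ⟨ξ, hξ⟩ (mem_univ _)⟩
  · exact ((continuous_apply ξ).tendsto _).comp tendsto_comap

end Density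

/-! ### Bounded positive approximation, and passage from `A` to `B(H)`. -/

section Kaplansky

variable {A H : Type*} [CStarAlgebra A] [NormedAddCommGroup H] [InnerProductSpace ℂ H]
  [CompleteSpace H] {π : A →⋆ₐ[ℂ] (H →L[ℂ] H)}

lemma cfc_inv_one_add_sq_mul (s : H →L[ℂ] H) (hs : IsSelfAdjoint s) :
    cfc (fun t : ℝ ↦ (1 + t ^ 2)⁻¹) s * (1 + s ^ 2) = 1 := by
  have hc : Continuous fun t : ℝ ↦ (1 + t ^ 2)⁻¹ :=
    (by fun_prop : Continuous fun t : ℝ ↦ 1 + t ^ 2).inv₀ fun t ↦ by positivity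
  have h1 : 1 + s ^ 2 = cfc (fun t : ℝ ↦ 1 + t ^ 2) s := by
    rw [cfc_add .., cfc_const_one .., cfc_pow_id ..]
  rw [h1, ← cfc_mul _ _ s hc.continuousOn (by fun_prop)]
  conv_rhs => rw [← cfc_const_one ℝ s]
  exact cfc_congr fun t _ ↦ inv_mul_cancel₀ (by positivity)

/-- The bounded function `(1 + t²)⁻¹` is strongly continuous on self-adjoint operators. -/
lemma tendsto_cfc_inv_one_add_sq {ι : Type*} {l : Filter ι} {s : ι → H →L[ℂ] H} {S : H →L[ℂ] H}
    (hs : ∀ i, IsSelfAdjoint (s i)) (hS : IsSelfAdjoint S)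
    (h : ∀ ξ, Tendsto (fun i ↦ s i ξ) l (𝓝 (S ξ))) (ξ : H) :
    Tendsto (fun i ↦ cfc (fun t : ℝ ↦ (1 + t ^ 2)⁻¹) (s i) ξ) l
      (𝓝 (cfc (fun t : ℝ ↦ (1 + t ^ 2)⁻¹) S ξ)) := by
  set r : ℝ → ℝ := fun t ↦ (1 + t ^ 2)⁻¹ with hr
  have hc : Continuous r :=
    (by fun_prop : Continuous fun t : ℝ ↦ 1 + t ^ 2).inv₀ fun t ↦ by positivity
  have hn1 (T : H →L[ℂ] H) : ‖cfc r T‖ ≤ 1 := norm_cfc_le zero_le_one fun t _ ↦ by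
    rw [hr, Real.norm_of_nonneg (by positivity)]
    exact inv_le_one_of_one_le₀ (by nlinarith [sq_nonneg t])
  have hn2 {T : H →L[ℂ] H} (hT : IsSelfAdjoint T) : ‖cfc r T * T‖ ≤ 1 := by
    have : cfc r T * T = cfc (fun t ↦ r t * t) T := by
      rw [cfc_mul r _ T hc.continuousOn (by fun_prop), cfc_id' ℝ T]
    rw [this]
    refine norm_cfc_le zero_le_one fun t _ ↦ ?_
    rw [hr, norm_mul, norm_inv, Real.norm_of_nonneg (by positivity : 0 ≤ 1 + t ^ 2),
      inv_mul_le_iff₀ (by positivity), Real.norm_eq_abs]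
    nlinarith [sq_nonneg (|t| - 1), sq_abs t]
  have hRS : (1 + S ^ 2) * cfc r S = 1 := by
    have hcomm : Commute (cfc r S) (1 + S ^ 2) :=
      ((Commute.one_right S).add_right ((Commute.refl S).pow_right 2)).cfc
        (by rw [hS.star_eq]; exact (Commute.one_right S).add_right ((Commute.refl S).pow_right 2)) r
    rw [← hcomm.eq, cfc_inv_one_add_sq_mul S hS]
  -- A resolvent-type identity: the possibly unbounded net `s i` enters only through the
  -- contractions `r(s i)` and `r(s i) s i`, and through `S - s i` acting on fixed vectors.
  have key (i : ι) : cfc r (s i) - cfc r S =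
      cfc r (s i) * ((S - s i) * (S * cfc r S)) + cfc r (s i) * s i * ((S - s i) * cfc r S) := by
    have h1 := cfc_inv_one_add_sq_mul (s i) (hs i)
    calc cfc r (s i) - cfc r S
        = cfc r (s i) * ((1 + S ^ 2) * cfc r S) - (cfc r (s i) * (1 + s i ^ 2)) * cfc r S := by
          rw [hRS, h1, mul_one, one_mul]
      _ = _ := by noncomm_ring
  rw [tendsto_iff_norm_sub_tendsto_zero]
  have hlim (v : H) : Tendsto (fun i ↦ ‖(S - s i) v‖) l (𝓝 0) := by
    simpa using ((tendsto_const_nhds (x := S v)).sub (h v)).norm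
  refine squeeze_zero (fun _ ↦ norm_nonneg _) (fun i ↦ ?_)
    (by simpa using (hlim (S (cfc r S ξ))).add (hlim (cfc r S ξ)))
  rw [← sub_apply, key]
  refine (norm_add_le _ _).trans (add_le_add ?_ ?_)
  · simpa using (cfc r (s i)).le_of_opNorm_le (hn1 _) ((S - s i) (S (cfc r S ξ)))
  · simpa using (cfc r (s i) * s i).le_of_opNorm_le (hn2 (hs i)) ((S - s i) (cfc r S ξ))

variable [PartialOrder A] [StarOrderedRing A]

/-- A form of Kaplansky's density theorem: a positive operator is a strong limit of a bounded net of
images of positive elements under an irreducible representation. -/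
lemma IsIrreducibleRep.exists_filter_nonneg (hπ : IsIrreducibleRep π) {x : H →L[ℂ] H}
    (hx : 0 ≤ x) :
    ∃ (l : Filter (selfAdjoint A)) (a : selfAdjoint A → A) (M : ℝ), l.NeBot ∧ (∀ i, 0 ≤ a i) ∧
      (∀ i, ‖a i‖ ≤ M) ∧ ∀ ξ, Tendsto (fun i ↦ π (a i) ξ) l (𝓝 (x ξ)) := by
  set r : ℝ → ℝ := fun t ↦ (1 + t ^ 2)⁻¹ with hr
  have hc : Continuous r :=
    (by fun_prop : Continuous fun t : ℝ ↦ 1 + t ^ 2).inv₀ fun t ↦ by positivity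
  have hr1 (t : ℝ) : r t ≤ 1 := inv_le_one_of_one_le₀ (by nlinarith [sq_nonneg t])
  have hr0 (t : ℝ) : 0 ≤ r t := by positivity
  set M : ℝ := ‖x‖ + 1 with hM
  -- On the spectrum of `x`, `g` is a right inverse of `h t = M - M / (1 + t²)`, which takes values
  -- in `[0, M)`. Approximating `g(x)` by self-adjoint `c` without norm control and then applying
  -- `h` gives positive elements bounded by `M`.
  let g : ℝ → ℝ := fun t ↦ √(t / (M - t))
  have hspec {t : ℝ} (ht : t ∈ spectrum ℝ x) : 0 ≤ t ∧ 0 < M - t := by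
    refine ⟨spectrum_nonneg_of_nonneg hx ht, ?_⟩
    have : Nontrivial H := hπ.1
    have := (le_abs_self t).trans (spectrum.norm_le_norm_of_mem ht)
    linarith
  have hg : ContinuousOn g (spectrum ℝ x) :=
    (continuousOn_id.div (by fun_prop) fun t ht ↦ (hspec ht).2.ne').sqrt
  obtain ⟨l, hl, hlim⟩ := hπ.exists_filter_selfAdjoint (T := cfc g x) (cfc_predicate g x)
  let h : ℝ → ℝ := fun t ↦ M - M * r t
  have hh : Continuous h := by fun_prop
  have hhg : cfc h (cfc g x) = x := by
    rw [← cfc_comp' h g x hh.continuousOn hg]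
    conv_rhs => rw [← cfc_id' ℝ x]
    refine cfc_congr fun t ht ↦ ?_
    obtain ⟨h0, h1⟩ := hspec ht
    have hM' : M ≠ 0 := by linarith
    simp only [h, g, hr, Real.sq_sqrt (div_nonneg h0 h1.le)]
    have : 1 + t / (M - t) = M / (M - t) := by field_simp; ring
    rw [this]
    field_simp
    ring
  refine ⟨l, fun s ↦ cfc h (s : A), M, hl, fun s ↦ cfc_nonneg fun t _ ↦ ?_,
    fun s ↦ norm_cfc_le (by positivity) fun t _ ↦ ?_, fun ξ ↦ ?_⟩
  · have : M * r t ≤ M * 1 := by gcongr; exact hr1 t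
    simp only [h]; linarith
  · have : M * r t ≤ M * 1 := by gcongr; exact hr1 t
    have : 0 ≤ M * r t := by positivity
    rw [Real.norm_eq_abs, abs_le]
    constructor <;> simp only [h] <;> linarith
  · have hmap (s : selfAdjoint A) : π (cfc h (s : A)) = cfc h (π s) :=
      StarAlgHomClass.map_cfc π h (s : A) hh.continuousOn (map_continuous π) s.2 (s.2.map π)
    have hlim' := tendsto_cfc_inv_one_add_sq (fun s : selfAdjoint A ↦ s.2.map π)
      (cfc_predicate g x) hlim ξ
    rw [← hhg]
    simp only [hmap]
    have hcfc (s : H →L[ℂ] H) (hs : IsSelfAdjoint s) :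
        cfc h s = algebraMap ℝ (H →L[ℂ] H) M - M • cfc r s := by
      rw [cfc_sub (fun _ ↦ M) (fun t ↦ M * r t) s continuousOn_const (by fun_prop), cfc_const M s hs,
        cfc_const_mul M r s hc.continuousOn]
    simp only [hcfc _ (cfc_predicate g x), fun s : selfAdjoint A ↦ hcfc _ (s.2.map π)]
    exact tendsto_const_nhds.sub (hlim'.const_smul M)

lemma map_cfc_of_nonneg {B : Type*} [CStarAlgebra B] [PartialOrder B] [StarOrderedRing B]
    (φ : A →⋆ₐ[ℂ] B) {f : ℝ → ℝ} (hf : ContinuousOn f (Ici 0)) {z : A} (hz : 0 ≤ z) :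
    φ (cfc f z) = cfc f (φ z) :=
  StarAlgHomClass.map_cfc φ f z (hf.mono fun _ ht ↦ spectrum_nonneg_of_nonneg hz ht)
    (map_continuous φ) hz.isSelfAdjoint (hz.isSelfAdjoint.map φ)

/-- `A`-monotone functions are monotone on `B(H)` for every irreducible representation on `H`. -/
theorem IsIrreducibleRep.monotoneClass_subset (hπ : IsIrreducibleRep π) :
    monotoneClass (Ici 0) A ⊆ monotoneClass (Ici 0) (H →L[ℂ] H) := by
  intro f hf
  rw [mem_monotoneClass_Ici_iff] at hf ⊢
  refine ⟨hf.1, fun x y hx hxy ↦ ?_⟩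
  obtain ⟨l, a, M, hl, ha0, haM, ha⟩ := hπ.exists_filter_nonneg hx
  -- Approximating `y - x` instead of `y` keeps the approximants ordered: `a ≤ a + d`.
  obtain ⟨l', d, M', hl', hd0, hdM, hd⟩ := hπ.exists_filter_nonneg (sub_nonneg.2 hxy)
  have hpos {z : A} (hz : 0 ≤ z) : 0 ≤ π z := map_nonneg π hz
  have hnorm (z : A) : ‖π z‖ ≤ ‖z‖ := NonUnitalStarAlgHom.norm_apply_le π z
  have hb0 (i : selfAdjoint A × selfAdjoint A) : 0 ≤ a i.1 + d i.2 := add_nonneg (ha0 _) (hd0 _)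
  have hbM (i : selfAdjoint A × selfAdjoint A) : ‖π (a i.1 + d i.2)‖ ≤ M + M' :=
    (hnorm _).trans
      ((norm_add_le _ _).trans (add_le_add (haM _) (hdM _)))
  have halim (ξ : H) : Tendsto (fun i : selfAdjoint A × selfAdjoint A ↦ π (a i.1) ξ) (l ×ˢ l')
      (𝓝 (x ξ)) := (ha ξ).comp tendsto_fst
  have hblim (ξ : H) : Tendsto (fun i : selfAdjoint A × selfAdjoint A ↦ π (a i.1 + d i.2) ξ)
      (l ×ˢ l') (𝓝 (y ξ)) := by
    simpa using (halim ξ).add ((hd ξ).comp tendsto_snd)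
  have hx_lim := tendsto_cfc_apply (T := fun i : selfAdjoint A × selfAdjoint A ↦ π (a i.1))
    (M := max M ‖x‖) (fun i ↦ hpos (ha0 i.1))
    (fun i ↦ ((hnorm _).trans (haM i.1)).trans (le_max_left _ _)) hx (le_max_right _ _) halim hf.1
  have hy_lim := tendsto_cfc_apply
    (T := fun i : selfAdjoint A × selfAdjoint A ↦ π (a i.1 + d i.2))
    (M := max (M + M') ‖y‖) (fun i ↦ hpos (hb0 i))
    (fun i ↦ (hbM i).trans (le_max_left _ _)) (hx.trans hxy) (le_max_right _ _) hblim hf.1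
  refine le_of_tendsto_apply hx_lim hy_lim fun i ↦ ?_
  rw [← map_cfc_of_nonneg π hf.1 (ha0 _), ← map_cfc_of_nonneg π hf.1 (hb0 i)]
  exact OrderHomClass.mono π (hf.2 _ _ (ha0 _) (le_add_of_nonneg_right (hd0 _)))

end Kaplansky

open scoped ComplexOrder

/-! ### States, in the topology of pointwise convergence. -/

section States

variable (A : Type*) [CStarAlgebra A] [PartialOrder A]

/-- The states of `A`, as a set of functions `A → ℂ`. -/
def stateSet : Set (A → ℂ) :=
  {φ | (∀ a b, φ (a + b) = φ a + φ b) ∧ (∀ (c : ℂ) a, φ (c • a) = c * φ a) ∧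
    (∀ a, 0 ≤ a → 0 ≤ φ a) ∧ φ 1 = 1}

variable {A}

lemma convex_stateSet : Convex ℝ (stateSet A) := by
  rintro φ hφ ψ hψ s t hs ht hst
  refine ⟨fun a b ↦ ?_, fun c a ↦ ?_, fun a ha ↦ ?_, ?_⟩
  · simp only [Pi.add_apply, Pi.smul_apply, hφ.1, hψ.1, smul_add]; ring
  · simp only [Pi.add_apply, Pi.smul_apply, hφ.2.1, hψ.2.1, Complex.real_smul]; ring
  · exact add_nonneg (smul_nonneg hs (hφ.2.2.1 a ha)) (smul_nonneg ht (hψ.2.2.1 a ha))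
  · simp only [Pi.add_apply, Pi.smul_apply, hφ.2.2.2, hψ.2.2.2, Complex.real_smul, mul_one]
    exact_mod_cast hst

variable [StarOrderedRing A]

/-- A state as a positive linear map. -/
noncomputable def stateSet.toPositiveLinearMap {φ : A → ℂ} (hφ : φ ∈ stateSet A) : A →ₚ[ℂ] ℂ :=
  PositiveLinearMap.mk₀
    { toFun := φ, map_add' := hφ.1, map_smul' := hφ.2.1 } hφ.2.2.1

/-- Four positive elements of norm at most `‖a‖` combine to `a`. The crude constant is enough for
compactness by Tychonoff. -/
lemma norm_apply_le_of_mem_stateSet {φ : A → ℂ} (hφ : φ ∈ stateSet A) (a : A) :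
    ‖φ a‖ ≤ 4 * ‖a‖ := by
  obtain ⟨y, hy0, hyn, hy⟩ := CStarAlgebra.exists_sum_four_nonneg a
  set f := stateSet.toPositiveLinearMap hφ
  have hbound (i : Fin 4) : ‖f (y i)‖ ≤ ‖a‖ := by
    have h1 : f 1 = 1 := hφ.2.2.2
    simpa [h1] using (f.norm_apply_le_of_nonneg _ (hy0 i)).trans
      (mul_le_mul_of_nonneg_left (hyn i) (norm_nonneg _))
  change ‖f a‖ ≤ _
  conv_lhs => rw [hy]
  rw [map_sum]
  refine (norm_sum_le _ _).trans ((Finset.sum_le_sum (g := fun _ ↦ ‖a‖) fun i _ ↦ ?_).trans ?_)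
  · simpa [norm_smul] using hbound i
  · simp

lemma isCompact_stateSet : IsCompact (stateSet A) := by
  refine (isCompact_univ_pi fun a : A ↦ isCompact_closedBall (0 : ℂ) (4 * ‖a‖)).of_isClosed_subset ?_
    fun φ hφ a _ ↦ by simpa using norm_apply_le_of_mem_stateSet hφ a
  simp only [stateSet, ofPred_and, ofPred_forall]
  refine .inter ?_ (.inter ?_ (.inter ?_ (isClosed_eq (by fun_prop) (by fun_prop))))
  · exact isClosed_iInter fun _ ↦ isClosed_iInter fun _ ↦ isClosed_eq (by fun_prop) (by fun_prop)
  · exact isClosed_iInter fun _ ↦ isClosed_iInter fun _ ↦ isClosed_eq (by fun_prop) (by fun_prop)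
  · exact isClosed_iInter fun _ ↦ isClosed_iInter fun _ ↦ isClosed_le (by fun_prop) (by fun_prop)

/-- A self-adjoint element which is nonnegative in every state is nonnegative. -/
lemma nonneg_of_forall_stateSet {a : A} (ha : IsSelfAdjoint a)
    (h : ∀ φ ∈ stateSet A, 0 ≤ φ a) : 0 ≤ a := by
  by_contra hneg
  have hconv : Convex ℝ {b : A | 0 ≤ b} := convex_Ici (0 : A)
  obtain ⟨f, u, hfa, hfb⟩ := RCLike.geometric_hahn_banach_point_closed (𝕜 := ℂ) hconv
    CStarAlgebra.isClosed_nonneg (x := a) hneg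
  have hu : u < 0 := by simpa using hfb 0 le_rfl
  have hpos {b : A} (hb : 0 ≤ b) : 0 ≤ (f b).re := by
    by_contra! hlt
    have := hfb ((u / (f b).re) • b) (smul_nonneg (div_nonneg_of_nonpos hu.le hlt.le) hb)
    rw [← Complex.coe_smul, map_smul, smul_eq_mul, RCLike.re_eq_complex_re,
      Complex.re_ofReal_mul, div_mul_cancel₀ _ hlt.ne] at this
    exact this.false
  -- The hermitian part of `f`: on self-adjoint elements it equals the real part of `f`, so it is a
  -- positive functional.
  let g : A → ℂ := fun b ↦ (f b + starRingEnd ℂ (f (star b))) / 2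
  have hgadd (b c : A) : g (b + c) = g b + g c := by simp [g]; ring
  have hgsmul (c : ℂ) (b : A) : g (c • b) = c * g b := by simp [g]; ring
  have hgsa {b : A} (hb : IsSelfAdjoint b) : g b = ((f b).re : ℂ) := by
    simp only [g, hb.star_eq, Complex.add_conj]
    push_cast; ring
  have hgpos {b : A} (hb : 0 ≤ b) : 0 ≤ g b := by
    rw [hgsa hb.isSelfAdjoint]
    exact_mod_cast hpos hb
  have hga : g a < 0 := by
    rw [hgsa ha]
    exact_mod_cast (show (f a).re < u from hfa).trans hu
  -- If `g 1 = 0`, then `‖a‖ + a ≥ 0` would force `g a ≥ 0`.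
  have hg1 : 0 < g 1 := by
    refine (hgpos zero_le_one).lt_of_ne fun h0 ↦ ?_
    have hle : 0 ≤ algebraMap ℝ A ‖a‖ + a := by
      have := IsSelfAdjoint.neg_algebraMap_norm_le_self ha
      simpa [add_comm] using sub_nonneg.2 this
    have := hgpos hle
    rw [hgadd, Algebra.algebraMap_eq_smul_one, ← Complex.coe_smul, hgsmul, ← h0, mul_zero,
      zero_add] at this
    exact hga.not_ge this
  have hinv : 0 < (g 1)⁻¹ := inv_pos.2 hg1
  have := h (fun b ↦ (g 1)⁻¹ * g b) ⟨fun b c ↦ by simp only [hgadd, mul_add],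
    fun c b ↦ by simp only [hgsmul]; ring, fun b hb ↦ mul_nonneg hinv.le (hgpos hb),
    inv_mul_cancel₀ hg1.ne'⟩
  exact (mul_neg_of_pos_of_neg hinv hga).not_ge this

/-- It suffices to test nonnegativity of a self-adjoint element in extreme states. -/
lemma nonneg_of_forall_extremePoints {a : A} (ha : IsSelfAdjoint a)
    (h : ∀ φ ∈ (stateSet A).extremePoints ℝ, 0 ≤ φ a) : 0 ≤ a := by
  refine nonneg_of_forall_stateSet ha fun φ hφ ↦ ?_
  rw [← closure_convexHull_extremePoints isCompact_stateSet convex_stateSet] at hφ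
  have hcl : IsClosed {φ : A → ℂ | 0 ≤ φ a} := isClosed_le (by fun_prop) (by fun_prop)
  have hcv : Convex ℝ {φ : A → ℂ | 0 ≤ φ a} := fun φ hφ ψ hψ s t hs ht _ ↦
    add_nonneg (smul_nonneg hs (show 0 ≤ φ a from hφ)) (smul_nonneg ht (show 0 ≤ ψ a from hψ))
  exact closure_minimal (convexHull_min h hcv) hcl hφ

end States

/-! ### Extreme states give irreducible GNS representations. -/

section GNS

variable {A : Type*} [CStarAlgebra A] [PartialOrder A] [StarOrderedRing A]

lemma gns_inner (f : A →ₚ[ℂ] ℂ) (a : A) :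
    inner ℂ (f.toPreGNS 1 : f.GNS) (f.gnsStarAlgHom a (f.toPreGNS 1 : f.GNS)) = f a := by
  simp [PositiveLinearMap.preGNS_inner_def]

lemma gns_cyclic (f : A →ₚ[ℂ] ℂ) :
    DenseRange fun a : A ↦ f.gnsStarAlgHom a (f.toPreGNS 1 : f.GNS) := by
  have : (fun a : A ↦ f.gnsStarAlgHom a (f.toPreGNS 1 : f.GNS)) =
      fun a : A ↦ ((f.toPreGNS a : f.PreGNS) : f.GNS) := by
    ext a; simp
  rw [this]
  exact UniformSpace.Completion.denseRange_coe.comp f.toPreGNS.surjective.denseRange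
    (UniformSpace.Completion.continuous_coe _)

lemma inner_map_nonneg {H : Type*} [NormedAddCommGroup H] [InnerProductSpace ℂ H] [CompleteSpace H]
    (π : A →⋆ₐ[ℂ] (H →L[ℂ] H)) {a : A} (ha : 0 ≤ a) (ζ : H) : 0 ≤ inner ℂ ζ (π a ζ) :=
  ((ContinuousLinearMap.nonneg_iff_isPositive _).1 (map_nonneg π ha)).inner_nonneg_right ζ

/-- The normalised vector functional of a nonzero vector is a state. -/
lemma vectorState_mem_stateSet {H : Type*} [NormedAddCommGroup H] [InnerProductSpace ℂ H]
    [CompleteSpace H] (π : A →⋆ₐ[ℂ] (H →L[ℂ] H)) {ζ : H} (hζ : ζ ≠ 0) :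
    (fun a ↦ ((‖ζ‖ ^ 2)⁻¹ : ℝ) • inner ℂ ζ (π a ζ)) ∈ stateSet A := by
  refine ⟨fun a b ↦ ?_, fun c a ↦ ?_, fun a ha ↦ ?_, ?_⟩
  · simp
  · simp [mul_left_comm]
  · exact smul_nonneg (by positivity) (inner_map_nonneg π ha ζ)
  · have : (‖ζ‖ : ℂ) ≠ 0 := by simpa using hζ
    simp [inner_self_eq_norm_sq_to_K, this]

/-- A cyclic representation whose vector state is extreme is irreducible. -/
lemma isIrreducibleRep_of_mem_extremePoints {H : Type*} [NormedAddCommGroup H]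
    [InnerProductSpace ℂ H] [CompleteSpace H] {π : A →⋆ₐ[ℂ] (H →L[ℂ] H)} {ξ : H}
    (hcyc : DenseRange fun a ↦ π a ξ)
    (hext : (fun a ↦ inner ℂ ξ (π a ξ)) ∈ (stateSet A).extremePoints ℝ) :
    IsIrreducibleRep π := by
  have hone : inner ℂ ξ ξ = (1 : ℂ) := by simpa using hext.1.2.2.2
  have hξ0 : ξ ≠ 0 := by rintro rfl; simp at hone
  have hξ1 : ‖ξ‖ ^ 2 = 1 := by
    rw [← inner_self_eq_norm_sq (𝕜 := ℂ), hone, RCLike.one_re]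
  refine ⟨⟨ξ, 0, hξ0⟩, fun K hK hinv ↦ ?_⟩
  have : CompleteSpace K := hK.completeSpace_coe
  have hcomm (a : A) (v : H) : K.starProjection (π a v) = π a (K.starProjection v) := by
    refine starProjection_apply_eq_of_invariant (T' := π (star a)) (fun v w ↦ ?_) (hinv a)
      (hinv (star a)) v
    rw [map_star, ContinuousLinearMap.star_eq_adjoint, ContinuousLinearMap.adjoint_inner_left]
  set p := K.starProjection ξ with hp
  set q := ξ - p with hq
  have hpK : p ∈ K := K.starProjection_apply_mem ξ
  have hqK : q ∈ Kᗮ := K.sub_starProjection_mem_orthogonal ξ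
  have hpq : p + q = ξ := by simp [hq]
  have hπq (a : A) : π a q ∈ Kᗮ := by
    rw [hq, map_sub, hp, ← hcomm]
    exact K.sub_starProjection_mem_orthogonal _
  by_cases hp0 : p = 0
  · left
    have h0 : (K.starProjection : H → H) = fun _ ↦ 0 :=
      hcyc.equalizer K.starProjection.continuous continuous_const <| by
        ext a; simp [hcomm, ← hp, hp0]
    rw [eq_bot_iff]
    intro v hv
    rw [← Submodule.starProjection_eq_self_iff.2 hv, h0]
    exact zero_mem _
  by_cases hq0 : q = 0
  · right
    have hξK : ξ ∈ K := by rw [← hpq, hq0, add_zero]; exact hpK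
    rw [eq_top_iff]
    intro v _
    refine closure_minimal ?_ hK (hcyc v)
    rintro _ ⟨a, rfl⟩
    exact hinv a ξ hξK
  exfalso
  have hp2 : 0 < ‖p‖ ^ 2 := by positivity
  have hq2 : 0 < ‖q‖ ^ 2 := by positivity
  have hnorm : ‖p‖ ^ 2 + ‖q‖ ^ 2 = 1 := by
    have := norm_add_sq_eq_norm_sq_add_norm_sq_of_inner_eq_zero p q
      (Submodule.inner_right_of_mem_orthogonal (𝕜 := ℂ) hpK hqK)
    rw [hpq] at this
    nlinarith
  have hsplit (a : A) : inner ℂ p (π a p) + inner ℂ q (π a q) = inner ℂ ξ (π a ξ) := by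
    conv_rhs => rw [← hpq]
    rw [map_add, inner_add_left, inner_add_right, inner_add_right,
      Submodule.inner_right_of_mem_orthogonal hpK (hπq a),
      Submodule.inner_left_of_mem_orthogonal (hinv a p hpK) hqK, add_zero, zero_add]
  -- When neither component vanishes, the state of `ξ` is a proper convex combination of the
  -- normalised states of `p` and `q`.
  have hseg : (fun a ↦ inner ℂ ξ (π a ξ)) ∈ openSegment ℝ
      (fun a ↦ ((‖p‖ ^ 2)⁻¹ : ℝ) • inner ℂ p (π a p))
      (fun a ↦ ((‖q‖ ^ 2)⁻¹ : ℝ) • inner ℂ q (π a q)) := by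
    refine ⟨‖p‖ ^ 2, ‖q‖ ^ 2, hp2, hq2, hnorm, ?_⟩
    ext a
    simp only [Pi.add_apply, Pi.smul_apply]
    rw [smul_inv_smul₀ hp2.ne', smul_inv_smul₀ hq2.ne', hsplit]
  have heq := (mem_extremePoints_iff_left.1 hext).2 _ (vectorState_mem_stateSet π hp0) _
    (vectorState_mem_stateSet π hq0) hseg
  -- Extremality identifies the state of `p` with that of `ξ`. By cyclicity `p` is then a multiple
  -- of `ξ`, which puts `ξ` in `K` and contradicts `q ≠ 0`.
  have horth (a : A) : inner ℂ (p - ((‖p‖ ^ 2 : ℝ) : ℂ) • ξ) (π a ξ) = 0 := by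
    have h1 : inner ℂ p (π a p) = inner ℂ p (π a ξ) := by
      conv_rhs => rw [← hpq, map_add, inner_add_right,
        Submodule.inner_right_of_mem_orthogonal hpK (hπq a), add_zero]
    have h2 := congr_fun heq a
    rw [inv_smul_eq_iff₀ hp2.ne', Complex.real_smul, h1] at h2
    rw [inner_sub_left, inner_smul_left, h2, Complex.conj_ofReal, sub_self]
  have hzero : p - ((‖p‖ ^ 2 : ℝ) : ℂ) • ξ = 0 := by
    have h0 : (fun v ↦ inner ℂ (p - ((‖p‖ ^ 2 : ℝ) : ℂ) • ξ) v) = fun _ ↦ (0 : ℂ) :=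
      hcyc.equalizer (by fun_prop) continuous_const (by ext a; exact horth a)
    exact inner_self_eq_zero.1 (congr_fun h0 _)
  have hξK : ξ ∈ K := by
    have hc : ((‖p‖ ^ 2 : ℝ) : ℂ) ≠ 0 := by exact_mod_cast hp2.ne'
    rw [← Submodule.smul_mem_iff K hc, ← sub_eq_zero.1 hzero]
    exact hpK
  exact hq0 (by rw [hq, hp, Submodule.starProjection_eq_self_iff.2 hξK, sub_self])

end GNS

/-! ### Irreducible representations detect the order of `A`. -/

section Separation

variable {A : Type u} [CStarAlgebra A] [PartialOrder A] [StarOrderedRing A]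

/-- A self-adjoint element whose image under every irreducible representation is nonnegative is
nonnegative. -/
theorem nonneg_of_forall_isIrreducibleRep {a : A} (ha : IsSelfAdjoint a)
    (h : ∀ (H : Type u) [NormedAddCommGroup H] [InnerProductSpace ℂ H] [CompleteSpace H]
      (π : A →⋆ₐ[ℂ] (H →L[ℂ] H)), IsIrreducibleRep π → 0 ≤ π a) : 0 ≤ a := by
  refine nonneg_of_forall_extremePoints ha fun φ hφ ↦ ?_
  let f := stateSet.toPositiveLinearMap hφ.1
  have hirr : IsIrreducibleRep f.gnsStarAlgHom := by
    refine isIrreducibleRep_of_mem_extremePoints (gns_cyclic f) ?_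
    simp only [gns_inner]
    exact hφ
  -- The GNS space lies in the universe of `A`, so `h` applies to it.
  have hpos := (ContinuousLinearMap.nonneg_iff_isPositive _).1 (h f.GNS f.gnsStarAlgHom hirr)
  have := hpos.inner_nonneg_right (f.toPreGNS 1 : f.GNS)
  rwa [gns_inner] at this

/-- If `f` is monotone on `B(H)` for every irreducible representation on `H`, then it is
`A`-monotone. -/
theorem mem_monotoneClass_of_forall_isIrreducibleRep {f : ℝ → ℝ} (hf : ContinuousOn f (Ici 0))
    (h : ∀ (H : Type u) [NormedAddCommGroup H] [InnerProductSpace ℂ H] [CompleteSpace H]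
      (π : A →⋆ₐ[ℂ] (H →L[ℂ] H)), IsIrreducibleRep π → f ∈ monotoneClass (Ici 0) (H →L[ℂ] H)) :
    f ∈ monotoneClass (Ici 0) A := by
  rw [mem_monotoneClass_Ici_iff]
  refine ⟨hf, fun x y hx hxy ↦ ?_⟩
  rw [← sub_nonneg]
  refine nonneg_of_forall_isIrreducibleRep ((cfc_predicate f y).sub (cfc_predicate f x))
    fun H _ _ _ π hπ ↦ ?_
  rw [map_sub, map_cfc_of_nonneg π hf hx, map_cfc_of_nonneg π hf (hx.trans hxy), sub_nonneg]
  exact (mem_monotoneClass_Ici_iff.1 (h H π hπ)).2 _ _ (map_nonneg π hx) (OrderHomClass.mono π hxy)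

theorem matrixMonotoneClass_subset_of_irrepDimsLE {n : ℕ} (h : IrrepDimsLE A n) :
    matrixMonotoneClass (Ici 0) n ⊆ monotoneClass (Ici 0) A := fun _ hf ↦
  mem_monotoneClass_of_forall_isIrreducibleRep hf.1 fun H _ _ _ π hπ ↦
    have := (h H π hπ).1
    matrixMonotoneClass_subset_of_finrank_le (h H π hπ).2 hf

theorem matrixMonotoneClassInf_subset_monotoneClass :
    matrixMonotoneClassInf (Ici 0) ⊆ monotoneClass (Ici 0) A := fun _ hf ↦
  mem_monotoneClass_of_forall_isIrreducibleRep (mem_iInter₂.1 hf 1 le_rfl).1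
    fun _ _ _ _ _ _ ↦ matrixMonotoneClassInf_subset hf

end Separation

/-! ### Assembly of the four statements. -/

lemma isOperatorMonotoneClass_matrixMonotoneClassInf :
    IsOperatorMonotoneClass.{w} (Ici 0) (matrixMonotoneClassInf (Ici 0)) :=
  ⟨rfl, fun _ _ _ _ hK ↦
    matrixMonotoneClassInf_subset.antisymm (subset_matrixMonotoneClassInf_of_infinite hK)⟩

lemma HasIrrepOfDim.monotoneClass_subset {A : Type u} [CStarAlgebra A] [PartialOrder A]
    [StarOrderedRing A] {m n : ℕ} (h : HasIrrepOfDim.{v} A n) (hm : m ≤ n) :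
    monotoneClass (Ici 0) A ⊆ matrixMonotoneClass (Ici 0) m := by
  obtain ⟨H, _, _, _, π, hπ, _, hn⟩ := h
  exact hπ.monotoneClass_subset.trans (subset_matrixMonotoneClass_of_le_finrank (hn ▸ hm))

theorem lemma2p1 (A : Type u) [CStarAlgebra A] [PartialOrder A] [StarOrderedRing A] :
    (∀ n : ℕ, HasIrrepOfDim.{v} A n →
      monotoneClass (Set.Ici 0) A ⊆ matrixMonotoneClass (Set.Ici 0) n) ∧
    (∀ n : ℕ, IrrepDimsLE A n →
      matrixMonotoneClass (Set.Ici 0) n ⊆ monotoneClass (Set.Ici 0) A) ∧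
    (¬ BddAbove {n : ℕ | HasIrrepOfDim.{v} A n} →
      IsOperatorMonotoneClass.{w} (Set.Ici 0) (monotoneClass (Set.Ici 0) A)) ∧
    (HasInfiniteDimIrrep.{v} A →
      IsOperatorMonotoneClass.{w} (Set.Ici 0) (monotoneClass (Set.Ici 0) A)) := by
  refine ⟨fun n h ↦ h.monotoneClass_subset le_rfl,
    fun n h ↦ matrixMonotoneClass_subset_of_irrepDimsLE h, fun h ↦ ?_, ?_⟩
  · have hsub : monotoneClass (Ici 0) A ⊆ matrixMonotoneClassInf (Ici 0) := by
      refine subset_iInter₂ fun m _ ↦ ?_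
      obtain ⟨n, hn, hmn⟩ := not_bddAbove_iff.1 h m
      exact hn.monotoneClass_subset hmn.le
    rw [hsub.antisymm matrixMonotoneClassInf_subset_monotoneClass]
    exact isOperatorMonotoneClass_matrixMonotoneClassInf
  · rintro ⟨H, _, _, _, π, hπ, hH⟩
    rw [(hπ.monotoneClass_subset.trans (subset_matrixMonotoneClassInf_of_infinite hH)).antisymm
      matrixMonotoneClassInf_subset_monotoneClass]
    exact isOperatorMonotoneClass_matrixMonotoneClassInf
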